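/- Let $f:\mathbb{R}^m\to\mathbb{R}$ be convex and $L$-smooth with $L>0$ (that is, $f$ is differentiable and $\nabla f$ is $L$-Lipschitz in the Euclidean norm), and let $x_\star$ be a minimizer of $f$. Let $x_0\in\mathbb{R}^m$, $D=\|x_0-x_\star\|$, $h\in(0,1]$, let $N>1$ be an integer, and let $x_1,\dots,x_N$ be the gradient descent iterates $x_{k+1}=x_k-\frac{h}{L}\nabla f(x_k)$. For $c\in\mathbb{R}$ put $x_\sigma=x_0+c(x_N-x_0)$. Let $\log$ be the natural logarithm and $\gamma$ the Euler–Mascheroni constant. If $$c = 1-\frac{1}{4N}+\sqrt{\frac{1}{16N^2}+\frac{1}{(2N+1)\left(\log N+\frac{1}{2N}+\gamma\right)}},$$ then $$f(x_\sigma)-f(x_\star)\le \frac{LD^2}{4Nh+\left(\sqrt{1+\frac{16N^2}{(2N+1)\left(\log N+\frac{1}{2N}+\gamma\right)}}-1\right)h+2}.$$ If instead $c = 1+\frac{1}{4\sqrt{N\log N}}$, then $$f(x_\sigma)-f(x_\star)\le \frac{LD^2}{4Nh+\sqrt{\frac{N}{\log N}}\,h+2}.$$ -/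

import Mathlib

open scoped Gradient

noncomputable section

/-- Convex and `L`-smooth functions on `ℝ^m`: differentiable and convex everywhere, with
`L`-Lipschitz gradient with respect to the Euclidean norm. -/
structure IsConvexLSmooth {m : ℕ} (L : ℝ) (f : EuclideanSpace ℝ (Fin m) → ℝ) : Prop where
  convex : ConvexOn ℝ Set.univ f
  differentiable : Differentiable ℝ f
  lipschitz_gradient : ∀ x y, ‖∇ f x - ∇ f y‖ ≤ L * ‖x - y‖

/-- The iterates of gradient descent, `x_{k+1} = x_k - (h_k / L) ∇f(x_k)`, started at `x₀`. -/
def gdIterate {m : ℕ} (L : ℝ) (h : ℕ → ℝ) (f : EuclideanSpace ℝ (Fin m) → ℝ)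
    (x₀ : EuclideanSpace ℝ (Fin m)) : ℕ → EuclideanSpace ℝ (Fin m)
  | 0 => x₀
  | k + 1 => gdIterate L h f x₀ k - (h k / L) • ∇ f (gdIterate L h f x₀ k)

/-- Simple extrapolation by the factor `c`: the point `x_σ = x_0 + c (x_N - x_0)`, where `x_N` is
the result of `N` gradient descent steps with constant stepsize `h_k = h`. -/
def simpleExtrapolation {m : ℕ} (L h : ℝ) (f : EuclideanSpace ℝ (Fin m) → ℝ)
    (x₀ : EuclideanSpace ℝ (Fin m)) (N : ℕ) (c : ℝ) : EuclideanSpace ℝ (Fin m) :=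
  x₀ + c • (gdIterate L (fun _ => h) f x₀ N - x₀)

/-- The extrapolation factor
`c_ℓ = 1 - 1/(4N) + √(1/(16N²) + 1/((2N+1)(log N + 1/(2N) + γ)))`. -/
def cLower (N : ℕ) : ℝ :=
  1 - 1 / (4 * (N : ℝ)) + √(1 / (16 * (N : ℝ) ^ 2) +
    1 / ((2 * (N : ℝ) + 1) *
      (Real.log N + 1 / (2 * (N : ℝ)) + Real.eulerMascheroniConstant)))

end

/-! The proof is a performance-estimation certificate. Normalise by `L` and write `g k` for the
gradients at the iterates, `s` for the one at the extrapolated point, `X` for `x₀ - xstar`, and `K =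
2Nc + 1`. Add the interpolation inequalities with weights `λ_k = multiplier c K k` (iterate `k`
against the minimizer), `μ_{k+1}` for the pair `(k, k+1)` and `μ_N` for the pair (last gradient
used, extrapolated point), where `μ = cumMultiplier c K`, and `1 - μ_N` (extrapolated point against
the minimizer). Since `μ_{k+1} = μ_k + λ_k`, all intermediate function values telescope away.
Completing the square in `X` with `M = 2Nhc + 1` then gives `2M (f(x_σ) - f(x_⋆)) ≤ L D²`, provided
that a quadratic form in `e k = g k - s` is nonnegative; the multipliers are such that no `s` terms
remain.

That form is affine in `h`. At `h = 0` it is a sum of squares plus Cauchy–Schwarz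
(`sum_le_sum_sub_consecutive`, `norm_sum_smul_sq_le`). At `h = 1` the variables are eliminated one
at a time (`norm_sq_le_of_pivots`), with pivots known in closed form (`pivot_succ`). Their
positivity follows from `(c-1)(1+2N(c-1))(2N+1)H_N ≤ 2N`, with `H_N` the harmonic number, and both
values of `c` satisfy this by upper bounds on `H_N`. -/

/-! ### Interpolation inequality for smooth convex functions. -/

section Smooth

variable {m : ℕ} {L : ℝ} {f : EuclideanSpace ℝ (Fin m) → ℝ}

theorem hasDerivAt_comp_line (hf : Differentiable ℝ f) (x v : EuclideanSpace ℝ (Fin m)) (t : ℝ) :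
    HasDerivAt (fun t : ℝ => f (x + t • v)) (inner ℝ (∇ f (x + t • v)) v) t := by
  have h1 : HasDerivAt (fun t : ℝ => x + t • v) v t := by
    simpa using ((hasDerivAt_id t).smul_const v).const_add x
  exact (hf (x + t • v)).hasGradientAt.hasFDerivAt.comp_hasDerivAt t h1

theorem ConvexOn.gradient_inner_le (hc : ConvexOn ℝ Set.univ f) (hf : Differentiable ℝ f)
    (x y : EuclideanSpace ℝ (Fin m)) : f x + inner ℝ (∇ f x) (y - x) ≤ f y := by
  have hline : ConvexOn ℝ Set.univ (fun t : ℝ => f (x + t • (y - x))) := by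
    refine ⟨convex_univ, fun s _ t _ a b ha hb hab => ?_⟩
    have h := hc.2 (Set.mem_univ (x + s • (y - x))) (Set.mem_univ (x + t • (y - x))) ha hb hab
    convert h using 2
    rw [smul_add, smul_add, add_add_add_comm, ← add_smul, hab, one_smul, smul_smul, smul_smul,
      ← add_smul]
    simp
  have hd := hasDerivAt_comp_line hf x (y - x) 0
  have h := hline.deriv_le_slope (Set.mem_univ 0) (Set.mem_univ 1) one_pos hd.differentiableAt
  rw [hd.deriv, slope_def_field, zero_smul, one_smul, add_zero, add_sub_cancel, sub_zero,
    div_one] at h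
  linarith

/-- The descent lemma. -/
theorem IsConvexLSmooth.le_quadratic (hf : IsConvexLSmooth L f)
    (x v : EuclideanSpace ℝ (Fin m)) :
    f (x + v) ≤ f x + inner ℝ (∇ f x) v + L / 2 * ‖v‖ ^ 2 := by
  let ψ : ℝ → ℝ := fun t => f (x + t • v) - t * inner ℝ (∇ f x) v - L / 2 * ‖v‖ ^ 2 * t ^ 2
  have hψ : ∀ t, HasDerivAt ψ
      (inner ℝ (∇ f (x + t • v)) v - inner ℝ (∇ f x) v - L / 2 * ‖v‖ ^ 2 * (2 * t)) t := by
    intro t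
    have h1 := hasDerivAt_comp_line hf.differentiable x v t
    have h2 := (hasDerivAt_id t).mul_const (inner ℝ (∇ f x) v)
    have h3 := (hasDerivAt_pow 2 t).const_mul (L / 2 * ‖v‖ ^ 2)
    refine ((h1.sub h2).sub h3).congr_deriv ?_
    push_cast
    ring
  have hanti : AntitoneOn ψ (Set.Icc 0 1) := by
    refine antitoneOn_of_deriv_nonpos (convex_Icc 0 1)
      (fun t _ => (hψ t).continuousAt.continuousWithinAt)
      (fun t _ => (hψ t).differentiableAt.differentiableWithinAt) fun t ht => ?_
    rw [interior_Icc] at ht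
    rw [(hψ t).deriv, ← inner_sub_left]
    have h1 := real_inner_le_norm (∇ f (x + t • v) - ∇ f x) v
    have h2 := hf.lipschitz_gradient (x + t • v) x
    rw [add_sub_cancel_left, norm_smul, Real.norm_of_nonneg ht.1.le] at h2
    have h3 := mul_le_mul_of_nonneg_right h2 (norm_nonneg v)
    nlinarith
  have h := hanti (Set.left_mem_Icc.2 zero_le_one) (Set.right_mem_Icc.2 zero_le_one) zero_le_one
  simp only [ψ, one_smul, zero_smul, add_zero] at h
  linarith

/-- Compare two bounds at the point `y + d / L`, with `d` the difference of gradients: the tangent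
plane at `x` from below and the descent lemma at `y` from above. The step `1 / L` gives the best
constant. -/
theorem IsConvexLSmooth.interpolation (hL : 0 < L) (hf : IsConvexLSmooth L f)
    (x y : EuclideanSpace ℝ (Fin m)) :
    f x + inner ℝ (∇ f x) (y - x) + 1 / (2 * L) * ‖∇ f x - ∇ f y‖ ^ 2 ≤ f y := by
  set d := ∇ f x - ∇ f y with hd
  have h1 := hf.convex.gradient_inner_le hf.differentiable x (y + (1 / L) • d)
  have h2 := hf.le_quadratic y ((1 / L) • d)
  have h3 : inner ℝ (∇ f x) ((1 / L) • d) - inner ℝ (∇ f y) ((1 / L) • d)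
      = 1 / L * ‖d‖ ^ 2 := by
    rw [← inner_sub_left, ← hd, inner_smul_right, real_inner_self_eq_norm_sq]
  rw [add_sub_right_comm, inner_add_right] at h1
  rw [norm_smul, mul_pow, Real.norm_of_nonneg (by positivity)] at h2
  have h4 : L / 2 * ((1 / L) ^ 2 * ‖d‖ ^ 2) = 1 / (2 * L) * ‖d‖ ^ 2 := by field_simp
  have h5 : 1 / L * ‖d‖ ^ 2 = 2 * (1 / (2 * L) * ‖d‖ ^ 2) := by field_simp
  linarith

theorem gradient_eq_zero_of_forall_le {x : EuclideanSpace ℝ (Fin m)} (hx : ∀ y, f x ≤ f y) :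
    ∇ f x = 0 := by
  have h : IsLocalMin f x := Filter.Eventually.of_forall hx
  simp [gradient, h.fderiv_eq_zero]

end Smooth

/-! ### Harmonic numbers against the logarithm. -/

section Harmonic

open Filter Topology

/-- This is `t ≤ sinh t` at `t = log x`. -/
theorem Real.log_le_half_sub_inv {x : ℝ} (hx : 1 ≤ x) : Real.log x ≤ (x - x⁻¹) / 2 := by
  have h := Real.self_le_sinh_iff.2 (Real.log_nonneg hx)
  rwa [Real.sinh_log (by linarith)] at h

/-- The sequence `H_n - log n - 1/(2n)` increases to `γ`; each increment is nonnegative by the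
previous bound at the ratio of consecutive integers. -/
theorem harmonic_le_log_add_inv_add_eulerMascheroni {n : ℕ} (hn : 1 ≤ n) :
    (harmonic n : ℝ) ≤ Real.log n + 1 / (2 * n) + Real.eulerMascheroniConstant := by
  let a : ℕ → ℝ := fun k => harmonic (k + 1) - Real.log ((k + 1 : ℕ) : ℝ) -
    1 / (2 * ((k + 1 : ℕ) : ℝ))
  have hmono : Monotone a := by
    refine monotone_nat_of_le_succ fun k => ?_
    have hk : (0 : ℝ) < (k : ℝ) + 1 := by positivity
    have h := Real.log_le_half_sub_inv (x := ((k : ℝ) + 1 + 1) / (k + 1))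
      (by rw [le_div_iff₀ hk]; linarith)
    rw [Real.log_div (by positivity) (by positivity)] at h
    have h2 : (((k : ℝ) + 1 + 1) / (k + 1) - (((k : ℝ) + 1 + 1) / (k + 1))⁻¹) / 2 =
        ((k : ℝ) + 1 + 1)⁻¹ + 1 / (2 * ((k : ℝ) + 1)) - 1 / (2 * ((k : ℝ) + 1 + 1)) := by
      field_simp
      ring
    simp only [a, harmonic_succ (k + 1)]
    push_cast
    linarith
  have hlim : Tendsto a atTop (𝓝 Real.eulerMascheroniConstant) := by
    have h1 := (tendsto_add_atTop_iff_nat 1).2 Real.tendsto_harmonic_sub_log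
    have h2 : Tendsto (fun k : ℕ => 1 / (2 * ((k + 1 : ℕ) : ℝ))) atTop (𝓝 0) := by
      have h3 := (tendsto_one_div_add_atTop_nhds_zero_nat (𝕜 := ℝ)).const_mul (1 / 2)
      rw [mul_zero] at h3
      refine h3.congr fun k => ?_
      push_cast
      field_simp
    rw [← sub_zero Real.eulerMascheroniConstant]
    exact h1.sub h2
  have h := hmono.ge_of_tendsto hlim (n - 1)
  simp only [a, Nat.sub_add_cancel hn] at h
  linarith

end Harmonic

/-! ### Multipliers and pivots in closed form. -/

section Multipliers

variable (c K : ℝ)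

/-- Partial sums of the multipliers of the interpolation inequalities with the minimizer. -/
noncomputable def cumMultiplier (n : ℕ) : ℝ := c * n / (K - n)

/-- The multipliers of the interpolation inequalities with the minimizer. -/
noncomputable def multiplier (n : ℕ) : ℝ := c * K / ((K - n - 1) * (K - n))

/-- The constants in the elimination of the first `n` gradients from the certificate. -/
noncomputable def residualDenom (n : ℕ) : ℝ := ∑ j ∈ Finset.range n, 1 / ((2 * j + 1) * K - 2 * j * (j + 1))

/-- The pivots, at step `n`, of the elimination of the first `n` gradients. -/
noncomputable def pivot (n : ℕ) : ℝ :=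
  c * K / (K - n) ^ 2 * (K - 2 * n - 1 / (c / ((c - 1) * K) - residualDenom K n))

variable {c K}

theorem cumMultiplier_zero : cumMultiplier c K 0 = 0 := by simp [cumMultiplier]

theorem cumMultiplier_succ {n : ℕ} (h : (n : ℝ) + 1 < K) :
    cumMultiplier c K (n + 1) = cumMultiplier c K n + multiplier c K n := by
  have h1 : K - n - 1 ≠ 0 := by linarith
  have h2 : K - n ≠ 0 := by linarith
  have h3 : K - (n + 1) ≠ 0 := by linarith
  simp only [cumMultiplier, multiplier]
  push_cast
  field_simp
  ring

theorem multiplier_pos (hc : 0 < c) {n : ℕ} (h : (n : ℝ) + 1 < K) : 0 < multiplier c K n := by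
  have h1 : 0 < K - n - 1 := by linarith
  have h2 : 0 < K - n := by linarith
  have h3 : 0 < K := by linarith [(Nat.cast_nonneg n : (0 : ℝ) ≤ n)]
  unfold multiplier
  positivity

theorem cumMultiplier_nonneg (hc : 0 < c) {n : ℕ} (h : (n : ℝ) < K) :
    0 ≤ cumMultiplier c K n := by
  have h2 : 0 < K - n := by linarith
  unfold cumMultiplier
  positivity

/-- This identity is what makes the terms linear in the translation `s` collapse in
`certificate_translate`. -/
theorem multiplier_mul {n : ℕ} (h : (n : ℝ) + 1 < K) :
    multiplier c K n * (K - n) = cumMultiplier c K (n + 1) + c := by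
  have h1 : K - n - 1 ≠ 0 := by linarith
  have h2 : K - n ≠ 0 := by linarith
  have h3 : K - (n + 1) ≠ 0 := by linarith
  simp only [cumMultiplier, multiplier]
  push_cast
  field_simp
  ring

theorem residualDenom_term_pos {n : ℕ} (h : (n : ℝ) + 1 ≤ K) :
    0 < (2 * n + 1) * K - 2 * n * (n + 1) := by
  have hn : (0 : ℝ) ≤ n := Nat.cast_nonneg n
  nlinarith

theorem pivot_zero (hc : 1 < c) (hK : 0 < K) : pivot c K 0 = 1 := by
  have : c - 1 ≠ 0 := by linarith
  simp [pivot, residualDenom]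
  field_simp
  ring

/-- The pivot recursion is of Riccati type; the reciprocal inside `pivot` linearises it, so that
each step only subtracts one summand of `residualDenom`. -/
theorem pivot_succ {n : ℕ} (h : 2 * (n : ℝ) + 2 < K)
    (h0 : 0 < c / ((c - 1) * K) - residualDenom K (n + 1)) :
    pivot c K (n + 1) * (pivot c K n + 2 * (K * cumMultiplier c K n)) =
      2 * (K * cumMultiplier c K (n + 1)) * pivot c K n - (K * multiplier c K n) ^ 2 := by
  have hn : (0 : ℝ) ≤ n := Nat.cast_nonneg n
  have hP := residualDenom_term_pos (n := n) (K := K) (by linarith)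
  have h1 : K - n - 1 ≠ 0 := by linarith
  have h2 : K - n ≠ 0 := by linarith
  have h3 : K - (n + 1) ≠ 0 := by linarith
  have hs : residualDenom K (n + 1) = residualDenom K n + 1 / ((2 * n + 1) * K - 2 * n * (n + 1)) :=
    Finset.sum_range_succ _ _
  simp only [pivot, cumMultiplier, multiplier]
  set z := c / ((c - 1) * K) - residualDenom K (n + 1) with hz
  have hz' : c / ((c - 1) * K) - residualDenom K n =
      z + 1 / ((2 * n + 1) * K - 2 * n * (n + 1)) := by rw [hz, hs]; ring
  rw [hz']
  generalize hPdef : (2 * (n : ℝ) + 1) * K - 2 * n * (n + 1) = P at *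
  have h5 : 1 / (z + 1 / P) = P / (z * P + 1) := by field_simp
  have h6 : z * P + 1 ≠ 0 := by positivity
  rw [h5]
  push_cast
  generalize (n : ℝ) = x at *
  field_simp
  subst hPdef
  ring

theorem residualDenom_mono {n N : ℕ} (h : n ≤ N) (hN : (N : ℝ) < K) :
    residualDenom K n ≤ residualDenom K N := by
  refine Finset.sum_le_sum_of_subset_of_nonneg (Finset.range_mono h) fun j hj _ => ?_
  have hj' : (j : ℝ) + 1 ≤ N := by exact_mod_cast Finset.mem_range.1 hj
  have := residualDenom_term_pos (hj'.trans hN.le)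
  positivity

/-- The bracket in `pivot` decreases with `n`, so its positivity at `N` suffices. -/
theorem pivot_pos (hc : 1 < c) {n N : ℕ} (hn : n ≤ N) (hN : 2 * (N : ℝ) < K)
    (h0 : 1 / (K - 2 * N) < c / ((c - 1) * K) - residualDenom K N) : 0 < pivot c K n := by
  have hn' : (n : ℝ) ≤ N := by exact_mod_cast hn
  have hn0 : (0 : ℝ) ≤ n := Nat.cast_nonneg n
  have h1 := residualDenom_mono hn (show (N : ℝ) < K by linarith)
  have h2 : 0 < K - 2 * N := by linarith
  have h3 : 0 < K - n := by linarith
  have hK : 0 < K := by linarith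
  have h4 : 1 / (K - 2 * N) < c / ((c - 1) * K) - residualDenom K n := by linarith
  have h5 : 1 / (c / ((c - 1) * K) - residualDenom K n) < K - 2 * N := by
    rw [div_lt_comm₀ ((one_div_pos.2 h2).trans h4) h2]
    exact h4
  have h6 : 0 < K - 2 * n - 1 / (c / ((c - 1) * K) - residualDenom K n) := by linarith
  unfold pivot
  positivity

end Multipliers

/-! ### Nonnegativity of the quadratic forms at `h = 1` and `h = 0`. -/

section QuadraticForms

variable {E : Type*} [NormedAddCommGroup E] [InnerProductSpace ℝ E]

open Finset

theorem norm_sum_smul_sq_le {w : ℕ → ℝ} (e : ℕ → E) {n : ℕ} (hw : ∀ k < n, 0 ≤ w k)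
    (h1 : ∑ k ∈ range n, w k ≤ 1) :
    ‖∑ k ∈ range n, w k • e k‖ ^ 2 ≤ ∑ k ∈ range n, w k * ‖e k‖ ^ 2 := by
  have h2 : ‖∑ k ∈ range n, w k • e k‖ ≤ ∑ k ∈ range n, w k * ‖e k‖ := by
    refine (norm_sum_le _ _).trans (le_of_eq (sum_congr rfl fun k hk => ?_))
    rw [norm_smul, Real.norm_of_nonneg (hw k (mem_range.1 hk))]
  have h3 : (∑ k ∈ range n, w k * ‖e k‖) ^ 2 ≤
      (∑ k ∈ range n, w k) * ∑ k ∈ range n, w k * ‖e k‖ ^ 2 := by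
    refine sum_sq_le_sum_mul_sum_of_sq_le_mul _ (fun k hk => hw k (mem_range.1 hk))
      (fun k hk => mul_nonneg (hw k (mem_range.1 hk)) (sq_nonneg _)) fun k _ => le_of_eq (by ring)
  have h4 : 0 ≤ ∑ k ∈ range n, w k * ‖e k‖ ^ 2 :=
    sum_nonneg fun k hk => mul_nonneg (hw k (mem_range.1 hk)) (sq_nonneg _)
  nlinarith [norm_nonneg (∑ k ∈ range n, w k • e k)]

theorem quadratic_nonneg {A B C : ℝ} (hA : 0 < A) (hABC : A * C = B ^ 2) (x y : E) :
    0 ≤ A * ‖x‖ ^ 2 + 2 * B * inner ℝ y x + C * ‖y‖ ^ 2 := by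
  have h : A * (A * ‖x‖ ^ 2 + 2 * B * inner ℝ y x + C * ‖y‖ ^ 2) = ‖A • x + B • y‖ ^ 2 := by
    rw [norm_add_sq_real, norm_smul, norm_smul, inner_smul_left, inner_smul_right,
      real_inner_comm, mul_pow, mul_pow, Real.norm_eq_abs, Real.norm_eq_abs, sq_abs, sq_abs,
      ← hABC]
    simp
    ring
  exact nonneg_of_mul_nonneg_right (h ▸ sq_nonneg _) hA

/-- Elimination of the variables `e k` in increasing order, with pivots `v`. -/
theorem norm_sq_le_of_pivots {q μ v : ℕ → ℝ} {N : ℕ} (hμ : ∀ n < N, 0 ≤ μ n) (hv0 : v 0 = 1)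
    (hv : ∀ n ≤ N, 0 < v n)
    (hrec : ∀ n < N, v (n + 1) * (v n + 2 * μ n) = 2 * μ (n + 1) * v n - q n ^ 2)
    (hq : ∀ n < N, μ (n + 1) = μ n + q n) (e : ℕ → E) {n : ℕ} (hn : n ≤ N) (y : E) :
    0 ≤ ∑ k ∈ range n, (2 * μ (k + 1) * ‖e k‖ ^ 2 +
        2 * q k * inner ℝ (e k) (∑ j ∈ range k, e j)) + 2 * inner ℝ y (∑ k ∈ range n, e k)
      - ‖∑ k ∈ range n, q k • e k + y‖ ^ 2 + ‖y‖ ^ 2 / v n := by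
  induction n generalizing y with
  | zero => simp [hv0]
  | succ n ih =>
    have hn' : n < N := hn
    -- The vector `y` stands for the contribution of variables not yet eliminated; the new one joins
    -- it with weight `q n`, which also produces the cross term of `e n` with the earlier sum.
    have h1 := ih hn'.le (q n • e n + y)
    have hvn := hv n hn'.le
    have hvn' := hv (n + 1) hn
    have hμn := hμ n hn'
    have hr := hrec n hn'
    -- What remains, multiplied by `v n`, is a form in `e n` and `y`; the recursion for `v` says
    -- exactly that its discriminant vanishes.
    have h2 := quadratic_nonneg (A := v (n + 1) * (v n + 2 * μ n)) (B := v n - q n)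
      (C := (v n - v (n + 1)) / v (n + 1)) (by positivity) (by
        field_simp
        rw [hq n hn'] at hr
        linear_combination -hr) (e n) y
    rw [sum_range_succ _ n, sum_range_succ _ n, sum_range_succ _ n,
      add_assoc (∑ k ∈ range n, q k • e k)]
    have h3 : ‖q n • e n + y‖ ^ 2 =
        q n ^ 2 * ‖e n‖ ^ 2 + 2 * q n * inner ℝ y (e n) + ‖y‖ ^ 2 := by
      rw [norm_add_sq_real, norm_smul, inner_smul_left, mul_pow, Real.norm_eq_abs, sq_abs,
        real_inner_comm]
      simp
      ring
    rw [inner_add_left, inner_smul_left, h3] at h1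
    rw [inner_add_right]
    have h4 : (v (n + 1) * (v n + 2 * μ n) * ‖e n‖ ^ 2 + 2 * (v n - q n) * inner ℝ y (e n) +
          (v n - v (n + 1)) / v (n + 1) * ‖y‖ ^ 2) / v n =
        2 * μ (n + 1) * ‖e n‖ ^ 2 + 2 * inner ℝ y (e n) + ‖y‖ ^ 2 / v (n + 1) -
          (q n ^ 2 * ‖e n‖ ^ 2 + 2 * q n * inner ℝ y (e n) + ‖y‖ ^ 2) / v n := by
      rw [hr]
      field_simp
      ring
    have h5 := h4 ▸ div_nonneg h2 hvn.le
    simp only [conj_trivial] at h1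
    linarith

/-- The part of the certificate form that does not depend on the cross terms with past gradients. -/
theorem sum_le_sum_sub_consecutive {q μ : ℕ → ℝ} {N : ℕ} (hμ : ∀ n ≤ N, 0 ≤ μ n) (hμ0 : μ 0 = 0)
    (hq : ∀ n < N, μ (n + 1) = μ n + q n) (e : ℕ → E) {n : ℕ} (hn : n ≤ N) :
    ∑ k ∈ range n, q k * ‖e k‖ ^ 2 + μ n * ‖e (n - 1)‖ ^ 2 ≤
      ∑ k ∈ range n, (2 * μ (k + 1) * ‖e k‖ ^ 2 - 2 * μ k * inner ℝ (e (k - 1)) (e k)) := by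
  induction n with
  | zero => simp [hμ0]
  | succ n ih =>
    have hn' : n < N := hn
    have h1 := ih hn'.le
    rw [sum_range_succ, sum_range_succ]
    -- At `n = 0` the index `n - 1` truncates to `0`, harmlessly, because `μ 0 = 0`.
    have h2 := mul_nonneg (hμ n hn'.le) (sq_nonneg ‖e (n - 1) - e n‖)
    rw [norm_sub_sq_real] at h2
    simp only [Nat.add_sub_cancel]
    rw [hq n hn'] at *
    nlinarith

end QuadraticForms

/-! ### The certificate and the rate for general `c`. -/

section Certificate

open Finset

/-- Termwise: `K / ((2j+1)K - 2j(j+1))` is nonincreasing in `K`, so the extreme case is `K = 2N +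
1`, where it is below `(2N+1) / (2N(j+1))`. -/
theorem mul_residualDenom_lt {N : ℕ} (hN : 1 ≤ N) {K : ℝ} (hK : 2 * (N : ℝ) + 1 ≤ K) :
    K * residualDenom K N < (2 * N + 1) * harmonic N / (2 * N) := by
  have hN' : (1 : ℝ) ≤ N := by exact_mod_cast hN
  have h : (2 * (N : ℝ) + 1) * harmonic N / (2 * N) =
      ∑ j ∈ range N, (2 * (N : ℝ) + 1) / (2 * N * (j + 1)) := by
    rw [harmonic]
    push_cast
    rw [mul_sum, sum_div]
    refine sum_congr rfl fun j _ => ?_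
    field_simp
  rw [h, residualDenom, mul_sum]
  refine sum_lt_sum_of_nonempty (nonempty_range_iff.2 (by omega)) fun j hj => ?_
  have hj : (j : ℝ) + 1 ≤ N := by exact_mod_cast mem_range.1 hj
  have hj0 : (0 : ℝ) ≤ j := Nat.cast_nonneg j
  have h1 := residualDenom_term_pos (n := j) (K := K) (by linarith)
  rw [mul_one_div, div_lt_div_iff₀ h1 (by positivity)]
  -- `2jN + 2j + 1` is the net coefficient of `K` after cross-multiplying.
  have h2 : (2 * (j : ℝ) * N + 2 * j + 1) * (2 * N + 1) ≤ (2 * j * N + 2 * j + 1) * K :=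
    mul_le_mul_of_nonneg_left hK (by positivity)
  have h3 : 0 ≤ (2 * (N : ℝ) + 1) * (2 * j * (N - (j + 1))) := by
    have : 0 ≤ (N : ℝ) - (j + 1) := by linarith
    positivity
  have h4 : 0 ≤ (N : ℝ) * j := by positivity
  nlinarith

variable {E : Type*} [NormedAddCommGroup E] [InnerProductSpace ℝ E]

/-- The matrix inequality behind the convergence rate, in the differences `e k` of the gradients
along the iterates with the gradient at the extrapolated point. -/
theorem certificate_nonneg {c K h : ℝ} {N : ℕ} (hc : 1 < c) (hN : 1 ≤ N)
    (hK : K = 2 * N * c + 1) (hh0 : 0 ≤ h) (hh1 : h ≤ 1)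
    (hcond : (c - 1) * (1 + 2 * N * (c - 1)) * ((2 * N + 1) * harmonic N) ≤ 2 * N) (e : ℕ → E) :
    0 ≤ ∑ k ∈ range N, (2 * cumMultiplier c K (k + 1) * ‖e k‖ ^ 2 +
          2 * h * multiplier c K k * inner ℝ (e k) (∑ j ∈ range k, e j) -
          2 * (1 - h) * cumMultiplier c K k * inner ℝ (e (k - 1)) (e k)) -
        (h * K + 1 - h) * ‖∑ k ∈ range N, multiplier c K k • e k‖ ^ 2 := by
  have hN' : (1 : ℝ) ≤ N := by exact_mod_cast hN
  have hδ : 0 < c - 1 := by linarith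
  have hNc : 0 < (N : ℝ) * (c - 1) := by positivity
  have hKN : 2 * (N : ℝ) + 1 ≤ K := by nlinarith
  have hK0 : 0 < K := by linarith
  have hcast : ∀ n ≤ N, (n : ℝ) ≤ N := fun n hn => by exact_mod_cast hn
  have hcast' : ∀ n < N, (n : ℝ) + 1 ≤ N := fun n hn => by exact_mod_cast hn
  have hD : 0 < 1 + 2 * (N : ℝ) * (c - 1) := by positivity
  have hpiv : 1 / (K - 2 * N) < c / ((c - 1) * K) - residualDenom K N := by
    have h1 := mul_residualDenom_lt hN hKN
    have h2 : (c - 1) * (1 + 2 * N * (c - 1)) * (K * residualDenom K N) < 1 := by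
      refine (mul_lt_mul_of_pos_left h1 (by positivity)).trans_le ?_
      rw [← mul_div_assoc, div_le_one (by positivity)]
      exact hcond
    have h3 : K - 2 * N = 1 + 2 * N * (c - 1) := by rw [hK]; ring
    -- This difference is the room left for `residualDenom K N`, and is where the shape of `hcond`
    -- comes from.
    have h4 : c / ((c - 1) * K) - 1 / (1 + 2 * N * (c - 1)) =
        1 / ((c - 1) * (1 + 2 * N * (c - 1)) * K) := by
      field_simp
      rw [hK]
      ring
    have h5 : residualDenom K N < 1 / ((c - 1) * (1 + 2 * N * (c - 1)) * K) := by
      rw [lt_div_iff₀ (by positivity)]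
      linarith
    rw [h3]
    linarith
  have hμ : ∀ n ≤ N, 0 ≤ cumMultiplier c K n := fun n hn =>
    cumMultiplier_nonneg (by linarith) (by linarith [hcast n hn])
  have hq : ∀ n < N, cumMultiplier c K (n + 1) = cumMultiplier c K n + multiplier c K n :=
    fun n hn => cumMultiplier_succ (by linarith [hcast' n hn])
  have hmain := norm_sq_le_of_pivots (q := fun n => K * multiplier c K n)
    (μ := fun n => K * cumMultiplier c K n) (v := pivot c K) (N := N)
    (fun n hn => mul_nonneg hK0.le (hμ n hn.le)) (pivot_zero hc hK0)
    (fun n hn => pivot_pos hc hn (by linarith) hpiv)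
    (fun n hn => pivot_succ (by linarith [hcast' n hn]) (by
      have h1 := residualDenom_mono (K := K) (show n + 1 ≤ N from hn) (by linarith)
      have h2 : 0 < 1 / (K - 2 * N) := one_div_pos.2 (by linarith)
      linarith))
    (fun n hn => by simp only [hq n hn]; ring) e le_rfl 0
  have hcons := sum_le_sum_sub_consecutive hμ cumMultiplier_zero hq e le_rfl
  have hsum : ∀ n ≤ N, ∑ k ∈ range n, multiplier c K k = cumMultiplier c K n := by
    intro n hn
    induction n with
    | zero => simp [cumMultiplier_zero]
    | succ n ih => rw [sum_range_succ, ih (by omega), hq n hn]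
  have hle : ∑ k ∈ range N, multiplier c K k ≤ 1 := by
    rw [hsum N le_rfl, cumMultiplier, div_le_one (by linarith), hK]
    nlinarith
  have hnorm := norm_sum_smul_sq_le e (fun k hk =>
    (multiplier_pos (c := c) (K := K) (n := k) (by linarith) (by linarith [hcast' k hk])).le) hle
  have hlast := mul_nonneg (hμ N le_rfl) (sq_nonneg ‖e (N - 1)‖)
  have h0 : 0 ≤ ∑ k ∈ range N, (2 * cumMultiplier c K (k + 1) * ‖e k‖ ^ 2 -
      2 * cumMultiplier c K k * inner ℝ (e (k - 1)) (e k)) -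
        ‖∑ k ∈ range N, multiplier c K k • e k‖ ^ 2 := by linarith
  have h1 : 0 ≤ ∑ k ∈ range N, (2 * cumMultiplier c K (k + 1) * ‖e k‖ ^ 2 +
      2 * multiplier c K k * inner ℝ (e k) (∑ j ∈ range k, e j)) -
        K * ‖∑ k ∈ range N, multiplier c K k • e k‖ ^ 2 := by
    refine nonneg_of_mul_nonneg_right (le_of_le_of_eq hmain ?_) hK0
    simp only [mul_smul, ← smul_sum]
    rw [add_zero, norm_smul, Real.norm_of_nonneg hK0.le, inner_zero_left, norm_zero, mul_sub,
      mul_sum]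
    have : ∀ k, K * (2 * cumMultiplier c K (k + 1) * ‖e k‖ ^ 2 +
        2 * multiplier c K k * inner ℝ (e k) (∑ j ∈ range k, e j)) =
        2 * (K * cumMultiplier c K (k + 1)) * ‖e k‖ ^ 2 +
        2 * (K * multiplier c K k) * inner ℝ (e k) (∑ j ∈ range k, e j) := fun k => by ring
    simp only [this]
    ring
  -- The form is the convex combination, with weights `h` and `1 - h`, of its cases `h = 1` and `h =
  -- 0`.
  have h2 := add_nonneg (mul_nonneg hh0 h1) (mul_nonneg (sub_nonneg.2 hh1) h0)
  refine le_of_le_of_eq h2 ?_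
  rw [mul_sub, mul_sub, mul_sum, mul_sum, sub_add_sub_comm, ← sum_add_distrib]
  congr 1
  · exact sum_congr rfl fun k _ => by ring
  · ring

/-- Translating all gradients by `s` changes the certificate form by these terms. -/
theorem certificate_translate {c K h : ℝ} {N : ℕ} (hK : (N : ℝ) < K) (e : ℕ → E) (s : E) {n : ℕ}
    (hn : n ≤ N) :
    ∑ k ∈ range n, (2 * cumMultiplier c K (k + 1) * ‖e k + s‖ ^ 2 +
          2 * h * multiplier c K k * inner ℝ (e k + s) (∑ j ∈ range k, (e j + s)) -
          2 * (1 - h) * cumMultiplier c K k * inner ℝ (e (k - 1) + s) (e k + s)) =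
      ∑ k ∈ range n, (2 * cumMultiplier c K (k + 1) * ‖e k‖ ^ 2 +
          2 * h * multiplier c K k * inner ℝ (e k) (∑ j ∈ range k, e j) -
          2 * (1 - h) * cumMultiplier c K k * inner ℝ (e (k - 1)) (e k)) +
      2 * (h * (cumMultiplier c K n - c) * inner ℝ s (∑ k ∈ range n, e k) +
        (1 - h) * cumMultiplier c K n * inner ℝ s (e (n - 1)) +
        (h * K + 1 - h) * inner ℝ s (∑ k ∈ range n, multiplier c K k • e k)) +
      (2 * h * n + 2 * (1 - h)) * cumMultiplier c K n * ‖s‖ ^ 2 := by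
  induction n with
  | zero => simp [cumMultiplier_zero]
  | succ n ih =>
    have hnN : (n : ℝ) + 1 ≤ N := by exact_mod_cast hn
    have h1 := multiplier_mul (c := c) (K := K) (n := n) (by linarith)
    have h2 := cumMultiplier_succ (c := c) (K := K) (n := n) (by linarith)
    rw [sum_range_succ, ih (by omega), sum_range_succ _ n, sum_range_succ e n,
      sum_range_succ (fun k => multiplier c K k • e k) n, norm_add_sq_real, sum_add_distrib,
      sum_const, card_range, ← Nat.cast_smul_eq_nsmul ℝ]
    simp only [inner_add_left, inner_add_right, inner_smul_right, Nat.add_sub_cancel,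
      real_inner_self_eq_norm_sq, real_inner_comm s]
    push_cast
    rw [h2] at h1 ⊢
    linear_combination (-2 * h * inner ℝ s (e n)) * h1

/-- The performance estimate for `N` gradient steps of size `h` followed by extrapolation by `c`,
in terms of the interpolation inequalities. Here `φ k`, `g k` are the values and gradients at the
iterates, `φs`, `s` those at the extrapolated point, and `X` is the starting point relative to
the minimizer. -/
theorem extrapolation_rate {c h : ℝ} {N : ℕ} (hc : 1 < c) (hN : 1 ≤ N)
    (hh0 : 0 ≤ h) (hh1 : h ≤ 1)
    (hcond : (c - 1) * (1 + 2 * N * (c - 1)) * ((2 * N + 1) * harmonic N) ≤ 2 * N)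
    (g : ℕ → E) (s X : E) (φ : ℕ → ℝ) (φs : ℝ)
    (hstar : ∀ k < N, φ k + ‖g k‖ ^ 2 / 2 ≤ inner ℝ (g k) (X - h • ∑ j ∈ range k, g j))
    (hstars : φs + ‖s‖ ^ 2 / 2 ≤ inner ℝ s (X - (c * h) • ∑ j ∈ range N, g j))
    (hchain : ∀ k, k + 1 < N →
      φ (k + 1) + h * inner ℝ (g k) (g (k + 1)) + ‖g k - g (k + 1)‖ ^ 2 / 2 ≤ φ k)
    (hlast : φs + inner ℝ s (h • g (N - 1) + ((c - 1) * h) • ∑ j ∈ range N, g j) +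
      ‖g (N - 1) - s‖ ^ 2 / 2 ≤ φ (N - 1)) :
    (4 * N * h * c + 2) * φs ≤ ‖X‖ ^ 2 := by
  have hN' : (1 : ℝ) ≤ N := by exact_mod_cast hN
  obtain ⟨K, hK⟩ : ∃ K : ℝ, K = 2 * N * c + 1 := ⟨_, rfl⟩
  have hKN : (N : ℝ) < K := by nlinarith
  have hcast' : ∀ n < N, (n : ℝ) + 1 ≤ N := fun n hn => by exact_mod_cast hn
  have hμ : ∀ n ≤ N, 0 ≤ cumMultiplier c K n := fun n hn =>
    cumMultiplier_nonneg (by linarith)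
      (lt_of_le_of_lt (by exact_mod_cast hn) hKN)
  have hind : ∀ n ≤ N, 2 * cumMultiplier c K n * φ (n - 1) +
      ∑ k ∈ range n, (2 * cumMultiplier c K (k + 1) * ‖g k‖ ^ 2 +
          2 * h * multiplier c K k * inner ℝ (g k) (∑ j ∈ range k, g j) -
          2 * (1 - h) * cumMultiplier c K k * inner ℝ (g (k - 1)) (g k)) -
        cumMultiplier c K n * ‖g (n - 1)‖ ^ 2 ≤
      2 * inner ℝ X (∑ k ∈ range n, multiplier c K k • g k) := by
    intro n hn
    induction n with
    | zero => simp [cumMultiplier_zero]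
    | succ n ih =>
      have h1 := ih (by omega)
      have h2 : multiplier c K n * (φ n + ‖g n‖ ^ 2 / 2) ≤
          multiplier c K n * inner ℝ (g n) (X - h • ∑ j ∈ range n, g j) :=
        mul_le_mul_of_nonneg_left (hstar n hn)
          (multiplier_pos (by linarith) (by linarith [hcast' n hn])).le
      have h3 : cumMultiplier c K n *
          (φ n + h * inner ℝ (g (n - 1)) (g n) + ‖g (n - 1) - g n‖ ^ 2 / 2) ≤
          cumMultiplier c K n * φ (n - 1) := by
        -- There is no pair before the first iterate; its weight `μ_0` is zero.
        rcases n with _ | n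
        · simp [cumMultiplier_zero]
        · exact mul_le_mul_of_nonneg_left (hchain n hn) (hμ _ (by omega))
      rw [norm_sub_sq_real] at h3
      rw [sum_range_succ, sum_range_succ (fun k => multiplier c K k • g k), inner_add_right,
        inner_smul_right, real_inner_comm (g n) X,
        cumMultiplier_succ (n := n) (by linarith [hcast' n hn])]
      rw [inner_sub_right, inner_smul_right] at h2
      simp only [Nat.add_sub_cancel]
      linarith
  obtain ⟨e, he⟩ : ∃ e : ℕ → E, g = fun k => e k + s := ⟨fun k => g k - s, by simp⟩
  subst he
  have hfin := hind N le_rfl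
  have hcert := certificate_nonneg hc hN hK hh0 hh1 hcond e
  rw [certificate_translate hKN e s le_rfl] at hfin
  have hsum : ∀ n ≤ N, ∑ k ∈ range n, multiplier c K k • (e k + s) =
      ∑ k ∈ range n, multiplier c K k • e k + cumMultiplier c K n • s := by
    intro n hn
    induction n with
    | zero => simp [cumMultiplier_zero]
    | succ n ih =>
      rw [sum_range_succ, sum_range_succ, ih (by omega),
        cumMultiplier_succ (n := n) (by linarith [hcast' n hn])]
      module
  rw [hsum N le_rfl] at hfin
  have hle : cumMultiplier c K N ≤ 1 := by
    rw [cumMultiplier, div_le_one (by linarith), hK]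
    nlinarith
  have hl := mul_le_mul_of_nonneg_left hlast (hμ N le_rfl)
  have hs := mul_le_mul_of_nonneg_left hstars (sub_nonneg.2 hle)
  clear hind hstar hstars hchain hlast hcond
  simp only [sum_add_distrib, sum_const, card_range, ← Nat.cast_smul_eq_nsmul ℝ,
    add_sub_cancel_right] at hl hs
  rw [norm_add_sq_real] at hfin
  simp only [inner_add_right, inner_sub_right, inner_smul_right,
    real_inner_self_eq_norm_sq, real_inner_comm s] at hfin hl hs
  set M := h * K + 1 - h with hM
  have hM1 : M = 2 * N * h * c + 1 := by rw [hM, hK]; ring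
  have hM0 : 0 < M := by rw [hM1]; positivity
  -- Since the weights sum to `1`, `∑ λ_k • e k + s` is the full weighted sum of gradients paired
  -- with `X`; this square trades that pairing for `‖X‖ ^ 2`.
  have hY := sq_nonneg ‖X - M • (∑ k ∈ range N, multiplier c K k • e k + s)‖
  rw [norm_sub_sq_real, norm_smul, mul_pow, norm_add_sq_real, inner_smul_right, inner_add_right,
    Real.norm_of_nonneg hM0.le, real_inner_comm s X, real_inner_comm s (∑ _ ∈ _, _)] at hY
  generalize inner ℝ s (∑ k ∈ range N, multiplier c K k • e k) = a1 at *
  generalize inner ℝ X (∑ k ∈ range N, multiplier c K k • e k) = a2 at *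
  generalize inner ℝ s (∑ k ∈ range N, e k) = a3 at *
  generalize inner ℝ s X = a4 at *
  generalize inner ℝ s (e (N - 1)) = a5 at *
  generalize ‖∑ k ∈ range N, multiplier c K k • e k‖ ^ 2 = a6 at *
  generalize cumMultiplier c K N = l at *
  have hfin' := mul_le_mul_of_nonneg_left hfin hM0.le
  have hl' := mul_le_mul_of_nonneg_left hl hM0.le
  have hs' := mul_le_mul_of_nonneg_left hs hM0.le
  have hcert' := mul_nonneg hM0.le hcert
  clear hfin hl hs hcert
  clear_value M
  subst hM1
  linarith

end Certificate

/-! ### From the abstract rate to gradient descent. -/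

theorem gdIterate_eq_sub_sum {m : ℕ} (L h : ℝ) (f : EuclideanSpace ℝ (Fin m) → ℝ)
    (x₀ : EuclideanSpace ℝ (Fin m)) (n : ℕ) :
    gdIterate L (fun _ => h) f x₀ n = x₀ - h • ∑ k ∈ Finset.range n,
      (1 / L) • ∇ f (gdIterate L (fun _ => h) f x₀ k) := by
  induction n with
  | zero => simp [gdIterate]
  | succ n ih =>
    rw [gdIterate, Finset.sum_range_succ, smul_add, ← sub_sub, ← ih, smul_smul, mul_one_div]

/-- Dividing values and gradients by `L` reduces to the normalised inequalities of
`extrapolation_rate`. -/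
theorem simpleExtrapolation_sub_le {m : ℕ} {L : ℝ} (hL : 0 < L)
    {f : EuclideanSpace ℝ (Fin m) → ℝ} (hf : IsConvexLSmooth L f)
    {xstar : EuclideanSpace ℝ (Fin m)} (hxstar : ∀ y, f xstar ≤ f y)
    (x₀ : EuclideanSpace ℝ (Fin m)) {h c : ℝ} (hh0 : 0 ≤ h) (hh1 : h ≤ 1) {N : ℕ} (hN : 1 ≤ N)
    (hc : 1 < c)
    (hcond : (c - 1) * (1 + 2 * N * (c - 1)) * ((2 * N + 1) * harmonic N) ≤ 2 * N) :
    f (simpleExtrapolation L h f x₀ N c) - f xstar ≤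
      L * ‖x₀ - xstar‖ ^ 2 / (4 * N * h * c + 2) := by
  obtain ⟨x, hx⟩ : ∃ x, x = gdIterate L (fun _ => h) f x₀ := ⟨_, rfl⟩
  obtain ⟨xs, hxs⟩ : ∃ xs, xs = simpleExtrapolation L h f x₀ N c := ⟨_, rfl⟩
  obtain ⟨g, hg⟩ : ∃ g : ℕ → EuclideanSpace ℝ (Fin m), g = fun k => (1 / L) • ∇ f (x k) :=
    ⟨_, rfl⟩
  have hxsum : ∀ n, x n = x₀ - h • ∑ k ∈ Finset.range n, g k := by
    intro n
    rw [hx, gdIterate_eq_sub_sum, hg, hx]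
  have hxssum : xs = x₀ - (c * h) • ∑ k ∈ Finset.range N, g k := by
    rw [hxs, simpleExtrapolation, ← hx, hxsum N]
    module
  have hint : ∀ y z, (f y - f xstar) / L + inner ℝ ((1 / L) • ∇ f y) (z - y) +
      ‖(1 / L) • ∇ f y - (1 / L) • ∇ f z‖ ^ 2 / 2 ≤ (f z - f xstar) / L := by
    intro y z
    have h1 := div_le_div_of_nonneg_right (hf.interpolation hL y z) hL.le
    rw [← smul_sub, norm_smul, mul_pow, inner_smul_left, Real.norm_of_nonneg (by positivity)]
    have h2 : (f y + inner ℝ (∇ f y) (z - y) + 1 / (2 * L) * ‖∇ f y - ∇ f z‖ ^ 2) / L =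
        f y / L + 1 / L * inner ℝ (∇ f y) (z - y) +
          (1 / L) ^ 2 * ‖∇ f y - ∇ f z‖ ^ 2 / 2 := by
      field_simp
    rw [h2] at h1
    simp only [conj_trivial, sub_div]
    linarith
  have hstar : ∀ y, (f y - f xstar) / L + ‖(1 / L) • ∇ f y‖ ^ 2 / 2 ≤
      inner ℝ ((1 / L) • ∇ f y) (y - xstar) := by
    intro y
    have h1 := hint y xstar
    rw [gradient_eq_zero_of_forall_le hxstar, smul_zero, sub_zero, sub_self, zero_div,
      ← neg_sub y xstar, inner_neg_right] at h1
    linarith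
  have hrate := extrapolation_rate hc hN hh0 hh1 hcond g ((1 / L) • ∇ f xs) (x₀ - xstar)
    (fun k => (f (x k) - f xstar) / L) ((f xs - f xstar) / L)
    (fun k _ => by
      have h1 := hstar (x k)
      rw [show x₀ - xstar - h • ∑ j ∈ Finset.range k, g j = x k - xstar by rw [hxsum k]; abel, hg]
      exact h1)
    (by
      rw [show x₀ - xstar - (c * h) • ∑ j ∈ Finset.range N, g j = xs - xstar by rw [hxssum]; abel]
      exact hstar xs)
    (fun k _ => by
      have h1 := hint (x (k + 1)) (x k)
      have h2 : x k - x (k + 1) = h • g k := by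
        rw [hxsum (k + 1), hxsum k, Finset.sum_range_succ]
        module
      rw [h2, inner_smul_right, norm_sub_rev] at h1
      simp only [hg] at h1 ⊢
      rw [real_inner_comm]
      exact h1)
    (by
      have h1 := hint xs (x (N - 1))
      have h2 : x (N - 1) - xs =
          h • g (N - 1) + ((c - 1) * h) • ∑ j ∈ Finset.range N, g j := by
        obtain ⟨n, rfl⟩ : ∃ n, N = n + 1 := ⟨N - 1, by omega⟩
        rw [hxssum, Nat.add_sub_cancel, hxsum n, Finset.sum_range_succ]
        module
      rw [h2, norm_sub_rev] at h1
      simp only [hg] at h1 ⊢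
      exact h1)
  rw [← hxs, le_div_iff₀ (by positivity)]
  have h1 := mul_le_mul_of_nonneg_left hrate hL.le
  refine le_of_eq_of_le ?_ h1
  field_simp

/-! ### The two extrapolation factors. -/

theorem one_lt_cLower {N : ℕ} (hN : 1 ≤ N) : 1 < cLower N := by
  have hN' : (1 : ℝ) ≤ N := by exact_mod_cast hN
  have hlog := Real.log_nonneg hN'
  have hγ : 0 < Real.eulerMascheroniConstant :=
    lt_trans (by norm_num) Real.one_half_lt_eulerMascheroniConstant
  have h1 : 1 / (4 * (N : ℝ)) < √(1 / (16 * (N : ℝ) ^ 2) +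
      1 / ((2 * (N : ℝ) + 1) *
        (Real.log N + 1 / (2 * (N : ℝ)) + Real.eulerMascheroniConstant))) := by
    refine Real.lt_sqrt_of_sq_lt ?_
    have h2 : (1 / (4 * (N : ℝ))) ^ 2 = 1 / (16 * (N : ℝ) ^ 2) := by ring
    rw [h2, lt_add_iff_pos_right]
    positivity
  unfold cLower
  linarith

/-- `cLower N - 1` is the positive root of the quadratic obtained by replacing `harmonic N` with its
upper bound and asking for equality. -/
theorem cLower_condition {N : ℕ} (hN : 1 ≤ N) :
    (cLower N - 1) * (1 + 2 * N * (cLower N - 1)) * ((2 * N + 1) * harmonic N) ≤ 2 * N := by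
  have hN' : (1 : ℝ) ≤ N := by exact_mod_cast hN
  have hlog := Real.log_nonneg hN'
  have hγ : 0 < Real.eulerMascheroniConstant :=
    lt_trans (by norm_num) Real.one_half_lt_eulerMascheroniConstant
  have hc := one_lt_cLower hN
  have hH := harmonic_le_log_add_inv_add_eulerMascheroni hN
  have hδ : 0 < cLower N - 1 := by linarith
  set B := Real.log N + 1 / (2 * (N : ℝ)) + Real.eulerMascheroniConstant with hB
  have hB0 : 0 < B := by positivity
  refine (mul_le_mul_of_nonneg_left (mul_le_mul_of_nonneg_left hH (by positivity))
    (by positivity)).trans (le_of_eq ?_)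
  have hsq : (cLower N - 1 + 1 / (4 * N)) ^ 2 =
      1 / (16 * (N : ℝ) ^ 2) + 1 / ((2 * (N : ℝ) + 1) * B) := by
    rw [cLower, ← hB]
    linear_combination Real.sq_sqrt
      (show 0 ≤ 1 / (16 * (N : ℝ) ^ 2) + 1 / ((2 * (N : ℝ) + 1) * B) by positivity)
  generalize cLower N - 1 = d at *
  have h1 : d * (1 + 2 * N * d) = 2 * N * (1 / ((2 * (N : ℝ) + 1) * B)) := by
    rw [← sub_eq_iff_eq_add'.2 hsq]
    field_simp
    ring
  rw [h1]
  field_simp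

theorem four_mul_mul_cLower {N : ℕ} (hN : 1 ≤ N) :
    4 * (N : ℝ) * cLower N = 4 * N + (√(1 + 16 * (N : ℝ) ^ 2 / ((2 * (N : ℝ) + 1) *
      (Real.log N + 1 / (2 * (N : ℝ)) + Real.eulerMascheroniConstant))) - 1) := by
  have hN' : (0 : ℝ) < N := by exact_mod_cast hN
  have h1 : ∀ B : ℝ, 1 + 16 * (N : ℝ) ^ 2 / B = (4 * N) ^ 2 * (1 / (16 * (N : ℝ) ^ 2) + 1 / B) := by
    intro B
    field_simp
    ring
  rw [h1, Real.sqrt_mul (by positivity), Real.sqrt_sq (by positivity), cLower]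
  field_simp
  ring

/-- With `H_N ≤ 1 + log N` there is slack: the left side is at most `0.8 (2N + 1)`, which is at most
`2N` once `N ≥ 2`. -/
theorem log_factor_condition {N : ℕ} (hN : 1 < N) :
    (1 / (4 * √((N : ℝ) * Real.log N))) * (1 + 2 * N * (1 / (4 * √((N : ℝ) * Real.log N)))) *
      ((2 * N + 1) * harmonic N) ≤ 2 * N := by
  have hN' : (2 : ℝ) ≤ N := by exact_mod_cast hN
  have hH := harmonic_le_one_add_log N
  have hl : 0.693 ≤ Real.log N := by
    have h1 := Real.log_le_log (by norm_num) hN'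
    linarith [Real.log_two_gt_d9]
  have hlN : Real.log N + 1 ≤ N := by
    linarith [Real.log_le_sub_one_of_pos (show (0 : ℝ) < N by linarith)]
  generalize Real.log N = l at *
  generalize hs : √((N : ℝ) * l) = s at *
  have hs2 : s ^ 2 = N * l := by rw [← hs, Real.sq_sqrt (by positivity)]
  have hs0 : 0 < s := by rw [← hs]; positivity
  have h1 : (1 / (4 * s)) * (1 + 2 * N * (1 / (4 * s))) = 1 / (4 * s) + 1 / (8 * l) := by
    have h2 : (1 / (4 * s)) * (1 + 2 * N * (1 / (4 * s))) = 1 / (4 * s) + N / (8 * s ^ 2) := by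
      field_simp
      ring
    rw [h2, hs2]
    field_simp
  -- After squaring, `N ≥ 1 + l` reduces this to `1 + l ≤ 2.56 l`, which holds already at `l =
  -- 0.693`.
  have h3 : 1 + l ≤ 1.6 * s := by
    refine le_of_sq_le_sq ?_ (by positivity)
    nlinarith
  have h4 : (1 / (4 * s) + 1 / (8 * l)) * (1 + l) ≤ 0.8 := by
    have h5 : 1 / (4 * s) * (1 + l) ≤ 0.4 := by
      rw [one_div_mul_eq_div, div_le_iff₀ (by positivity)]
      linarith
    have h6 : 1 / (8 * l) * (1 + l) ≤ 0.4 := by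
      rw [one_div_mul_eq_div, div_le_iff₀ (by positivity)]
      linarith
    linarith
  rw [h1]
  have h7 : 0 < 1 / (4 * s) + 1 / (8 * l) := by positivity
  calc _ ≤ (1 / (4 * s) + 1 / (8 * l)) * ((2 * N + 1) * (1 + l)) := by gcongr
    _ = (2 * N + 1) * ((1 / (4 * s) + 1 / (8 * l)) * (1 + l)) := by ring
    _ ≤ (2 * N + 1) * 0.8 := by gcongr
    _ ≤ 2 * N := by linarith

theorem four_mul_mul_log_factor {N : ℕ} (hN : 1 < N) :
    4 * (N : ℝ) * (1 + 1 / (4 * √((N : ℝ) * Real.log N))) = 4 * N + √((N : ℝ) / Real.log N) := by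
  have hN' : (1 : ℝ) < N := by exact_mod_cast hN
  have hl := Real.log_pos hN'
  have h1 : √((N : ℝ) / Real.log N) = N / √((N : ℝ) * Real.log N) := by
    rw [Real.sqrt_eq_iff_mul_self_eq_of_pos (by positivity), div_mul_div_comm,
      Real.mul_self_sqrt (by positivity)]
    field_simp
  rw [h1]
  field_simp

theorem corollary4p3 {m : ℕ} (L : ℝ) (hL : 0 < L)
    (f : EuclideanSpace ℝ (Fin m) → ℝ) (hf : IsConvexLSmooth L f)
    (xstar : EuclideanSpace ℝ (Fin m)) (hxstar : ∀ y, f xstar ≤ f y)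
    (x₀ : EuclideanSpace ℝ (Fin m)) (D : ℝ) (hD : D = ‖x₀ - xstar‖)
    (h : ℝ) (hh : h ∈ Set.Ioc (0 : ℝ) 1) (N : ℕ) (hN : 1 < N) :
    f (simpleExtrapolation L h f x₀ N (cLower N)) - f xstar ≤
        L * D ^ 2 /
          (4 * (N : ℝ) * h +
            (√(1 + 16 * (N : ℝ) ^ 2 /
              ((2 * (N : ℝ) + 1) *
                (Real.log N + 1 / (2 * (N : ℝ)) + Real.eulerMascheroniConstant))) - 1) * h + 2) ∧
    f (simpleExtrapolation L h f x₀ N (1 + 1 / (4 * √((N : ℝ) * Real.log N)))) - f xstar ≤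
        L * D ^ 2 / (4 * (N : ℝ) * h + √((N : ℝ) / Real.log N) * h + 2) := by
  have hN1 : 1 ≤ N := hN.le
  have hlog := Real.log_pos (show (1 : ℝ) < N by exact_mod_cast hN)
  subst hD
  refine ⟨?_, ?_⟩
  · refine (simpleExtrapolation_sub_le hL hf hxstar x₀ hh.1.le hh.2 hN1 (one_lt_cLower hN1)
      (cLower_condition hN1)).trans_eq ?_
    rw [← add_mul, ← four_mul_mul_cLower hN1, mul_right_comm]
  · refine (simpleExtrapolation_sub_le hL hf hxstar x₀ hh.1.le hh.2 hN1
      (c := 1 + 1 / (4 * √((N : ℝ) * Real.log N))) ?_ ?_).trans_eq ?_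
    · rw [lt_add_iff_pos_right]
      positivity
    · rw [add_sub_cancel_left]
      exact log_factor_condition hN
    · rw [← add_mul, ← four_mul_mul_log_factor hN, mul_right_comm]
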